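/- All spaces are Tychonoff. A Tychonoff space $X$ is a $k_R$-space if a function $f:X\to\mathbb{R}$ is continuous if and only if its restriction to every compact subset of $X$ is continuous. A space $X$ is a $k$-space if a set $F\subseteq X$ is closed in $X$ whenever $F\cap K$ is closed in $K$ for every compact $K\subseteq X$. For a Tychonoff space $X$ let $A(X)$ be the free Abelian topological group over $X$, i.e. the free Abelian group on the set $X$ with the finest group topology that makes the canonical map $X\to A(X)$ continuous, and let $A_n(X)$ be its subspace of all elements $r_1x_1+\cdots+r_kx_k$ (with $x_i\in X$ distinct and $r_i\in\mathbb{Z}$) of reduced length $\sum_{i}|r_i|\le n$. Let $C=\{0\}\cup\{1/n: n\ge 1\}\subset\mathbb{R}$, and let $P_0$ be the countable metric fan: the (metrizable) space $\{y_0\}\cup\{y(n,m): n,m\in\mathbb{N}\}$, with pairwise distinct points, in which every $y(n,m)$ is isolated and the sets $\{y_0\}\cup\{y(n,m): n\ge k,\ m\in\mathbb{N}\}$, $k\in\mathbb{N}$, form a neighbourhood base at $y_0$. Let $\mathbf{G}_0=\bigoplus_{i\in\mathbb{N}}C_i\oplus P_0$ be the topological sum of $P_0$ and of countably infinitely many copies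 $C_i$ of $C$. Then the subspace $A_3(\mathbf{G}_0)$ of $A(\mathbf{G}_0)$ is not a $k_R$-space; in particular, it is not a $k$-space. -/

import Mathlib

open Topology Filter

namespace KRFree

/-- A `k_R`-space: a Tychonoff space on which a real-valued function is continuous if and only if
its restriction to every compact subset is continuous. -/
def IsKRSpace (X : Type*) [TopologicalSpace X] : Prop :=
  T35Space X ∧
    ∀ f : X → ℝ, Continuous f ↔ ∀ K : Set X, IsCompact K → ContinuousOn f K

/-! ### Free Abelian topological groups -/

/-- The free Abelian topological group `A(X)`: algebraically the free Abelian group on `X`. -/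
def FreeAbTop (X : Type*) : Type _ := FreeAbelianGroup X

namespace FreeAbTop

instance (X : Type*) : AddCommGroup (FreeAbTop X) :=
  inferInstanceAs (AddCommGroup (FreeAbelianGroup X))

/-- The canonical map `X → A(X)`. -/
def of {X : Type*} (x : X) : FreeAbTop X := FreeAbelianGroup.of x

/-- The homomorphism `A(X) → G` extending a map `X → G`. -/
def lift {X G : Type*} [AddCommGroup G] (f : X → G) : FreeAbTop X →+ G :=
  FreeAbelianGroup.lift f

/-- `A(X)` carries the finest group topology for which `of : X → A(X)` is continuous. -/
instance (X : Type*) [TopologicalSpace X] : TopologicalSpace (FreeAbTop X) :=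
  (AddGroupTopology.coinduced (of : X → FreeAbTop X)).toTopologicalSpace

instance (X : Type*) [TopologicalSpace X] : IsTopologicalAddGroup (FreeAbTop X) :=
  (AddGroupTopology.coinduced (of : X → FreeAbTop X)).toIsTopologicalAddGroup

theorem lift_of {X G : Type*} [AddCommGroup G] (f : X → G) (x : X) : lift f (of x) = f x :=
  FreeAbelianGroup.lift_apply_of f x

theorem closure_range_of (X : Type*) :
    AddSubgroup.closure (Set.range (of : X → FreeAbTop X)) = ⊤ := by
  refine (AddSubgroup.eq_top_iff' _).2 fun g => ?_
  induction g using FreeAbelianGroup.induction_on with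
  | zero => exact AddSubgroup.zero_mem _
  | of x => exact AddSubgroup.subset_closure ⟨x, rfl⟩
  | neg x h => exact AddSubgroup.neg_mem _ h
  | add x y hx hy => exact AddSubgroup.add_mem _ hx hy

theorem continuous_of (X : Type*) [TopologicalSpace X] :
    Continuous (of : X → FreeAbTop X) := by
  rw [continuous_iff_coinduced_le]
  exact AddGroupTopology.coinduced_continuous (of : X → FreeAbTop X) |>.coinduced_le

/-- The universal property of `A(X)`. -/
theorem continuous_lift {X G : Type*} [TopologicalSpace X] [AddCommGroup G] [TopologicalSpace G]
    [IsTopologicalAddGroup G] (f : X → G) (hf : Continuous f) :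
    Continuous (lift f : FreeAbTop X → G) := by
  let b : AddGroupTopology (FreeAbTop X) :=
    { toTopologicalSpace := TopologicalSpace.induced (lift f) inferInstance
      toIsTopologicalAddGroup := topologicalAddGroup_induced (lift f) }
  rw [continuous_iff_le_induced]
  have h : AddGroupTopology.coinduced (of : X → FreeAbTop X) ≤ b := by
    refine sInf_le ?_
    change TopologicalSpace.coinduced _ _ ≤ TopologicalSpace.induced _ _
    rw [← continuous_iff_coinduced_le, continuous_induced_rng]
    exact hf.congr fun x => (lift_of f x).symm
  exact h

/-- The reduced length `∑ |rᵢ|` of `g = r₁x₁ + ⋯ + rₙxₙ` (distinct `xᵢ`). -/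
noncomputable def length {X : Type*} (g : FreeAbTop X) : ℕ :=
  (FreeAbelianGroup.toFinsupp (show FreeAbelianGroup X from g)).sum fun _ r => r.natAbs

end FreeAbTop

/-- `A_n(X)`: the words of reduced length at most `n`. Coerced to a type, it carries the subspace
topology from `A(X)`. -/
def A (n : ℕ) (X : Type*) : Set (FreeAbTop X) := {g | g.length ≤ n}

/-! ### The spaces `P₀` and `G₀` -/

/-- The countable metric fan `P₀`: a point `center` and disjoint infinite countable pieces
`Xₙ = {pt n m : m ∈ ℕ}`, `n ∈ ℕ`. -/
inductive P0 : Type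
  | center : P0
  | pt (n m : ℕ) : P0

namespace P0

/-- The set `V_k = {center} ∪ ⋃_{n ≥ k} Xₙ`. -/
def V (k : ℕ) : Set P0 := {center} ∪ {p | ∃ n m, k ≤ n ∧ p = pt n m}

/-- All points `pt n m` are isolated, and the sets `V k` form a neighbourhood base at `center`. -/
instance : TopologicalSpace P0 where
  IsOpen U := center ∈ U → ∃ k, V k ⊆ U
  isOpen_univ := fun _ => ⟨0, Set.subset_univ _⟩
  isOpen_inter := by
    rintro s t hs ht ⟨h1, h2⟩
    obtain ⟨k, hk⟩ := hs h1
    obtain ⟨l, hl⟩ := ht h2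
    refine ⟨max k l, ?_⟩
    rintro p (rfl | ⟨n, m, hn, rfl⟩)
    · exact ⟨h1, h2⟩
    · exact ⟨hk (Or.inr ⟨n, m, le_trans (le_max_left _ _) hn, rfl⟩),
        hl (Or.inr ⟨n, m, le_trans (le_max_right _ _) hn, rfl⟩)⟩
  isOpen_sUnion := by
    rintro S hS ⟨s, hs, hc⟩
    obtain ⟨k, hk⟩ := hS s hs hc
    exact ⟨k, fun p hp => ⟨s, hs, hk hp⟩⟩

theorem isOpen_iff (U : Set P0) : IsOpen U ↔ (center ∈ U → ∃ k, V k ⊆ U) := Iff.rfl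

theorem isOpen_V (k : ℕ) : IsOpen (V k) := fun _ => ⟨k, subset_rfl⟩

theorem isOpen_of_center_notMem {U : Set P0} (h : center ∉ U) : IsOpen U :=
  fun hc => (h hc).elim

theorem isClosed_of_center_mem {U : Set P0} (h : center ∈ U) : IsClosed U :=
  ⟨isOpen_of_center_notMem fun h' => h' h⟩

theorem hasBasis_nhds_center : (𝓝 center).HasBasis (fun _ : ℕ => True) V := by
  refine ⟨fun t => ?_⟩
  simp only [true_and]
  constructor
  · intro ht
    obtain ⟨U, hU, hUo, hc⟩ := mem_nhds_iff.1 ht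
    obtain ⟨k, hk⟩ := hUo hc
    exact ⟨k, hk.trans hU⟩
  · rintro ⟨k, hk⟩
    exact mem_of_superset ((isOpen_V k).mem_nhds (Or.inl rfl)) hk

theorem nhds_pt (n m : ℕ) : 𝓝 (pt n m) = pure (pt n m) :=
  (isOpen_singleton_iff_nhds_eq_pure _).1 (isOpen_of_center_notMem (by simp))

instance : Countable P0 :=
  Function.Surjective.countable (f := fun o : Option (ℕ × ℕ) =>
    o.elim center fun q => pt q.1 q.2) (by
      rintro (_ | ⟨n, m⟩)
      · exact ⟨none, rfl⟩
      · exact ⟨some (n, m), rfl⟩)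

instance : T2Space P0 := by
  have key : ∀ n m, ∀ q : P0, q ≠ pt n m →
      ∃ u v : Set P0, IsOpen u ∧ IsOpen v ∧ q ∈ u ∧ pt n m ∈ v ∧ Disjoint u v := by
    intro n m q hq
    refine ⟨{pt n m}ᶜ, {pt n m}, fun _ => ⟨n + 1, ?_⟩, isOpen_of_center_notMem (by simp), hq, rfl,
      disjoint_compl_left⟩
    rintro p (rfl | ⟨a, b, hab, rfl⟩) <;> simp
    omega
  refine ⟨fun p q hpq => ?_⟩
  rcases q with _ | ⟨n, m⟩
  · rcases p with _ | ⟨a, b⟩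
    · exact (hpq rfl).elim
    · obtain ⟨u, v, hu, hv, h1, h2, h3⟩ := key a b center (by simp)
      exact ⟨v, u, hv, hu, h2, h1, h3.symm⟩
  · exact key n m p hpq

instance : RegularSpace P0 := by
  have h : ∀ a : P0, (𝓝 a).HasBasis (fun _ : ℕ => True)
      (fun k => match a with | center => V k | pt n m => {pt n m}) := by
    rintro (_ | ⟨n, m⟩)
    · exact hasBasis_nhds_center
    · refine ⟨fun t => ?_⟩
      simp [nhds_pt]
  refine RegularSpace.of_hasBasis h ?_
  rintro (_ | ⟨n, m⟩) k -
  · exact isClosed_of_center_mem (Or.inl rfl)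
  · exact isClosed_singleton

instance : FirstCountableTopology P0 := by
  refine ⟨?_⟩
  rintro (_ | ⟨n, m⟩)
  · exact hasBasis_nhds_center.isCountablyGenerated
  · rw [nhds_pt]; infer_instance

instance : SecondCountableTopology P0 := inferInstance

instance : TopologicalSpace.MetrizableSpace P0 := inferInstance

end P0

/-- The convergent sequence `C = {1/n : n ≥ 1} ∪ {0}`, with the subspace topology of `ℝ`. -/
def C : Set ℝ := {x | ∃ n : ℕ, 1 ≤ n ∧ x = 1 / (n : ℝ)} ∪ {0}

/-- `G₀`: the topological sum of countably many copies of `C` and of `P₀`. -/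
abbrev G0 : Type := (Σ _ : ℕ, C) ⊕ P0

end KRFree

/-! Write `x_{i,k}` for the isolated points of the copy `C_i` and `x_i` for its limit. The words
`w_{i,k} = x_{i,k} - x_i + y(i,k)` have length at most 3 and accumulate at the center `y_0` of the
fan: choose `i` making `y(i,k)` close to `y_0` for all `k`, then `k` making `x_{i,k} - x_i` close to
`0`. Each `w_{i,k}` lies in a clopen `cell (i, k)` missing `y_0`, and a compact set meets only
finitely many cells (`finite_cell_inter`). Hence the indicator of the union of the cells is
continuous on every compact set but not at `y_0`, which refutes both properties. -/

namespace KRFree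

/-! ### Coefficients and compact sets in free Abelian topological groups. -/

namespace FreeAbTop

variable {X : Type*}

open Classical in
/-- The coefficient of the generator `x`, as a homomorphism `A(X) → ℤ`. -/
noncomputable def coef (x : X) : FreeAbTop X →+ ℤ := lift (Pi.single x 1)

@[simp]
theorem coef_of_self (x : X) : coef x (of x) = 1 := by simp [coef, lift_of]

theorem coef_of_of_ne {x y : X} (h : y ≠ x) : coef x (of y) = 0 := by simp [coef, lift_of, h]

theorem hom_ext {G : Type*} [AddCommGroup G] {f g : FreeAbTop X →+ G}
    (h : ∀ x, f (of x) = g (of x)) : f = g :=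
  FreeAbelianGroup.lift_ext _ _ h

theorem continuous_coef [TopologicalSpace X] {x : X} (h : IsClopen {x}) :
    Continuous (coef x : FreeAbTop X → ℤ) := by
  classical
  refine continuous_lift _ ?_
  have : (Pi.single x 1 : X → ℤ) = Set.indicator {x} 1 := by
    ext y
    simp [Pi.single_apply, Set.indicator_apply]
  rw [this]
  exact h.continuous_indicator continuous_one

/-- A compact subset of `A(X)` involves only finitely many points of a closed discrete family of
isolated points of `X`. -/
theorem finite_coef_ne_zero [TopologicalSpace X] {ι : Type*} {p : ι → X}
    (hp : Function.Injective p) (hopen : ∀ i, IsOpen {p i}) (hclosed : IsClosed (Set.range p))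
    {K : Set (FreeAbTop X)} (hK : IsCompact K) :
    {i | ∃ g ∈ K, coef (p i) g ≠ 0}.Finite := by
  -- For the discrete topology, `lift φ` is continuous, so the image of `K` is finite and involves
  -- finitely many supports.
  let _ : TopologicalSpace (ι →₀ ℤ) := ⊥
  have : DiscreteTopology (ι →₀ ℤ) := ⟨rfl⟩
  let φ : X → ι →₀ ℤ := Function.extend p (fun i => Finsupp.single i 1) 0
  have hφ0 : ∀ x ∉ Set.range p, φ x = 0 := fun x hx => Function.extend_apply' _ _ _ hx
  have hφ : Continuous φ := by
    refine continuous_iff_continuousAt.2 fun x => ?_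
    by_cases hx : x ∈ Set.range p
    · obtain ⟨i, rfl⟩ := hx
      rw [ContinuousAt, (isOpen_singleton_iff_nhds_eq_pure _).1 (hopen i)]
      exact tendsto_pure_nhds _ _
    · refine (continuousAt_const (y := (0 : ι →₀ ℤ))).congr ?_
      filter_upwards [hclosed.isOpen_compl.mem_nhds hx] with y hy using (hφ0 y hy).symm
  have hcoef : ∀ i g, lift φ g i = coef (p i) g := by
    intro i g
    have : (Finsupp.applyAddHom i).comp (lift φ) = coef (p i) := by
      refine hom_ext fun x => ?_
      simp only [AddMonoidHom.comp_apply, lift_of, Finsupp.applyAddHom_apply]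
      by_cases hx : x ∈ Set.range p
      · obtain ⟨j, rfl⟩ := hx
        simp only [φ, hp.extend_apply]
        by_cases hij : j = i
        · subst hij; simp
        · rw [coef_of_of_ne (hp.ne hij), Finsupp.single_eq_of_ne (Ne.symm hij)]
      · rw [hφ0 x hx, coef_of_of_ne (fun h => hx ⟨i, h.symm⟩)]; rfl
    exact DFunLike.congr_fun this g
  have hfin := (hK.image (continuous_lift φ hφ)).finite_of_discrete
  refine (hfin.biUnion fun v _ => v.support.finite_toSet).subset ?_
  rintro i ⟨g, hg, hi⟩
  refine Set.mem_biUnion (Set.mem_image_of_mem _ hg) ?_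
  simpa [hcoef] using hi

theorem length_sub_add_le {x y z : X} (hxy : x ≠ y) (hxz : x ≠ z) (hyz : y ≠ z) :
    (of x - of y + of z).length ≤ 3 := by
  classical
  have h : FreeAbelianGroup.toFinsupp (show FreeAbelianGroup X from of x - of y + of z) =
      Finsupp.single x 1 - Finsupp.single y 1 + Finsupp.single z 1 := by
    change FreeAbelianGroup.toFinsupp
      (FreeAbelianGroup.of x - FreeAbelianGroup.of y + FreeAbelianGroup.of z) = _
    simp
  rw [length, h, Finsupp.sum_of_support_subset (s := {x, y, z})]
  · simp [Finset.sum_insert, Finsupp.single_apply, hxy, hxz, hyz, hxy.symm, hxz.symm, hyz.symm]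
  · intro w hw
    by_contra hn
    simp only [Finset.mem_insert, Finset.mem_singleton, not_or] at hn
    simp [Ne.symm hn.1, Ne.symm hn.2.1, Ne.symm hn.2.2] at hw
  · simp

theorem length_of_le (x : X) : (of x).length ≤ 1 := by
  have h : FreeAbelianGroup.toFinsupp (show FreeAbelianGroup X from of x) =
      Finsupp.single x 1 := FreeAbelianGroup.toFinsupp_of x
  rw [length, h]
  simp

end FreeAbTop

/-! ### The convergent sequence. -/

namespace C

/-- The limit point of `C`. -/
def zero : C := ⟨0, Or.inr rfl⟩

/-- The isolated point `1 / (k + 1)` of `C`. -/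
noncomputable def term (k : ℕ) : C := ⟨1 / ((k + 1 : ℕ) : ℝ), Or.inl ⟨k + 1, by simp, rfl⟩⟩

theorem term_ne_zero (k : ℕ) : term k ≠ zero := by
  intro h
  have := congrArg Subtype.val h
  simp only [term, zero] at this
  have h2 : (0 : ℝ) < 1 / ((k + 1 : ℕ) : ℝ) := by positivity
  exact h2.ne' this

theorem tendsto_term : Tendsto term atTop (𝓝 zero) := by
  rw [tendsto_subtype_rng]
  simpa [term, zero] using tendsto_one_div_add_atTop_nhds_zero_nat (𝕜 := ℝ)

theorem isOpen_singleton_term (k : ℕ) : IsOpen {term k} := by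
  -- Writing `k * x < 1` instead of `x < 1 / k` also covers `k = 0`, where `1 / k` would be `0`.
  have h : {term k} = {x : C | 1 / ((k : ℝ) + 2) < x ∧ k * (x : ℝ) < 1} := by
    ext ⟨x, hx⟩
    rw [Set.mem_singleton_iff, Subtype.ext_iff]
    change x = 1 / ((k + 1 : ℕ) : ℝ) ↔ 1 / ((k : ℝ) + 2) < x ∧ k * x < 1
    constructor
    · rintro rfl
      push_cast
      refine ⟨one_div_lt_one_div_of_lt (by positivity) (by linarith), ?_⟩
      rw [mul_one_div, div_lt_one (by positivity)]
      linarith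
    · rintro ⟨h1, h2⟩
      rcases hx with ⟨n, hn, rfl⟩ | rfl
      · have hn' : (0 : ℝ) < n := by exact_mod_cast hn
        rw [one_div_lt_one_div (by positivity) hn'] at h1
        rw [mul_one_div, div_lt_one hn'] at h2
        have h3 : n < k + 2 := by exact_mod_cast h1
        have h4 : k < n := by exact_mod_cast h2
        rw [show n = k + 1 by omega]
      · have : (0 : ℝ) < 1 / ((k : ℝ) + 2) := by positivity
        exact absurd h1 this.not_gt
  rw [h]
  exact (isOpen_lt continuous_const continuous_subtype_val).inter
    (isOpen_lt (continuous_const.mul continuous_subtype_val) continuous_const)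

end C

/-! ### Cells and the discontinuous indicator. -/

namespace G0

/-- The point `1 / (k + 1)` of the copy `C_i` of `C`. -/
noncomputable def seq (i k : ℕ) : G0 := Sum.inl ⟨i, C.term k⟩

/-- The limit point of the copy `C_i` of `C`. -/
def lim (i : ℕ) : G0 := Sum.inl ⟨i, C.zero⟩

/-- The point `pt i k` of the summand `P₀`. -/
def fan (i k : ℕ) : G0 := Sum.inr (P0.pt i k)

/-- The center of the summand `P₀`. -/
def center : G0 := Sum.inr P0.center

theorem seq_ne_lim (i k j : ℕ) : seq i k ≠ lim j := by
  intro h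
  simp only [seq, lim, Sum.inl.injEq, Sigma.mk.injEq] at h
  obtain ⟨rfl, h⟩ := h
  exact C.term_ne_zero k (eq_of_heq h)

theorem seq_ne_fan (i k j l : ℕ) : seq i k ≠ fan j l := by simp [seq, fan]

theorem lim_ne_fan (i j l : ℕ) : lim i ≠ fan j l := by simp [lim, fan]

theorem isOpen_singleton_seq (i k : ℕ) : IsOpen {seq i k} := by
  have : {seq i k} = Sum.inl '' (Sigma.mk (β := fun _ : ℕ => C) i '' {C.term k}) := by
    simp [seq]
  rw [this]
  exact isOpenMap_inl _ (isOpenMap_sigmaMk _ (C.isOpen_singleton_term k))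

theorem isOpen_singleton_fan (i k : ℕ) : IsOpen {fan i k} := by
  have : {fan i k} = Sum.inr '' {P0.pt i k} := by simp [fan]
  rw [this]
  exact isOpenMap_inr _ (P0.isOpen_of_center_notMem (by simp))

/-- Each summand `C_i` contains exactly one of these points, and `P₀` none. -/
theorem isClosed_range_seq (k : ℕ → ℕ) : IsClosed (Set.range fun i => seq i (k i)) := by
  rw [isClosed_sum_iff, isClosed_sigma_iff]
  refine ⟨fun i => ?_, ?_⟩
  · convert (isClosed_singleton : IsClosed {C.term (k i)}) using 1
    ext x
    simp only [Set.mem_preimage, Set.mem_range, seq, Sum.inl.injEq, Set.mem_singleton_iff]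
    constructor
    · rintro ⟨j, hj⟩
      obtain ⟨rfl, h⟩ := Sigma.mk.inj_iff.1 hj
      exact (eq_of_heq h).symm
    · rintro rfl
      exact ⟨i, rfl⟩
  · convert (isClosed_empty : IsClosed (∅ : Set P0)) using 1
    ext x
    simp [seq]

/-- The neighbourhood `V (i + 1)` of the center misses the `i`-th piece. -/
theorem isClosed_range_fan (i : ℕ) : IsClosed (Set.range (fan i)) := by
  have : Set.range (fan i) = Sum.inr '' Set.range (P0.pt i) := by
    rw [← Set.range_comp]; rfl
  rw [this]
  refine Topology.IsClosedEmbedding.inr.isClosedMap _ ⟨fun _ => ⟨i + 1, ?_⟩⟩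
  rintro p (rfl | ⟨n, m, hn, rfl⟩)
  · simp
  · simp only [Set.mem_compl_iff, Set.mem_range, P0.pt.injEq, not_exists, not_and]
    omega

theorem seq_injective (k : ℕ → ℕ) : Function.Injective fun i => seq i (k i) := by
  intro i j h
  simp only [seq, Sum.inl.injEq, Sigma.mk.injEq] at h
  exact h.1

theorem fan_injective (i : ℕ) : Function.Injective (fan i) := by
  intro k l h
  simpa [fan] using h

theorem tendsto_seq (i : ℕ) : Tendsto (seq i) atTop (𝓝 (lim i)) :=
  ((continuous_inl.comp (continuous_sigmaMk (σ := fun _ : ℕ => C) (i := i))).tendsto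
    C.zero).comp C.tendsto_term

open FreeAbTop

/-- The elements of `A(G₀)` whose coefficients at `1 / (k + 1) ∈ C_i` and at `pt i k` are `1`. -/
def cell (d : ℕ × ℕ) : Set (FreeAbTop G0) :=
  {g | coef (seq d.1 d.2) g = 1 ∧ coef (fan d.1 d.2) g = 1}

theorem isClopen_cell (d : ℕ × ℕ) : IsClopen (cell d) := by
  have h1 := (isClopen_discrete ({1} : Set ℤ)).preimage
    (continuous_coef ⟨isClosed_singleton, isOpen_singleton_seq d.1 d.2⟩)
  have h2 := (isClopen_discrete ({1} : Set ℤ)).preimage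
    (continuous_coef ⟨isClosed_singleton, isOpen_singleton_fan d.1 d.2⟩)
  exact h1.inter h2

/-- Fan coefficients bound `k` for each fixed `i`; sequence coefficients, along one chosen `k` per
`i`, bound the set of `i`. -/
theorem finite_cell_inter {K : Set (FreeAbTop G0)} (hK : IsCompact K) :
    {d | (cell d ∩ K).Nonempty}.Finite := by
  classical
  let S : Set (ℕ × ℕ) := {d | (cell d ∩ K).Nonempty}
  have hrow : ∀ i, {k | (i, k) ∈ S}.Finite := fun i =>
    (finite_coef_ne_zero (fan_injective i) (isOpen_singleton_fan i) (isClosed_range_fan i)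
      hK).subset fun k ⟨g, hg, hgK⟩ => ⟨g, hgK, by rw [hg.2]; exact one_ne_zero⟩
  -- Choose one index in each nonempty row of `S`; on empty rows the value `0` is arbitrary.
  have hex : ∀ i, ∃ k, (∃ l, (i, l) ∈ S) → (i, k) ∈ S := fun i => by
    by_cases h : ∃ l, (i, l) ∈ S
    · exact ⟨h.choose, fun _ => h.choose_spec⟩
    · exact ⟨0, fun h' => (h h').elim⟩
  choose k hk using hex
  have hI : {i | ∃ l, (i, l) ∈ S}.Finite :=
    (finite_coef_ne_zero (seq_injective k) (fun i => isOpen_singleton_seq i (k i))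
      (isClosed_range_seq k) hK).subset fun i hi => by
        obtain ⟨g, hg, hgK⟩ := hk i hi
        exact ⟨g, hgK, by rw [hg.1]; exact one_ne_zero⟩
  refine (hI.biUnion fun i _ => (hrow i).image (Prod.mk i)).subset ?_
  rintro ⟨i, l⟩ h
  exact Set.mem_biUnion (show i ∈ {i | ∃ l, (i, l) ∈ S} from ⟨l, h⟩) ⟨l, h, rfl⟩

theorem mem_cell (i k : ℕ) : of (seq i k) - of (lim i) + of (fan i k) ∈ cell (i, k) := by
  constructor
  · simp [coef_of_of_ne (seq_ne_lim i k i).symm, coef_of_of_ne (seq_ne_fan i k i k).symm]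
  · simp [coef_of_of_ne (seq_ne_fan i k i k), coef_of_of_ne (lim_ne_fan i i k)]

theorem of_center_notMem_cell (d : ℕ × ℕ) : of center ∉ cell d := fun h => by
  have h1 := h.1
  rw [coef_of_of_ne (by simp [center, seq])] at h1
  exact zero_ne_one h1

theorem exists_mem_of_mem_nhds_center {N : Set (FreeAbTop G0)} (hN : N ∈ 𝓝 (of center)) :
    ∃ i k, of (seq i k) - of (lim i) + of (fan i k) ∈ N := by
  have hadd : Tendsto (fun q : FreeAbTop G0 × FreeAbTop G0 => q.1 + q.2)
      (𝓝 0 ×ˢ 𝓝 (of center)) (𝓝 (of center)) := by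
    have := (continuous_add (M := FreeAbTop G0)).tendsto (0, of center)
    rwa [zero_add, nhds_prod_eq] at this
  obtain ⟨U, hU, W, hW, hUW⟩ := mem_prod_iff.1 (hadd hN)
  -- The index `i` depends only on `W`; `k` is then chosen from `U` and `i`, with no uniformity in
  -- `i` needed.
  obtain ⟨i, -, hi⟩ := P0.hasBasis_nhds_center.mem_iff.1
    (((continuous_of G0).comp continuous_inr).continuousAt.preimage_mem_nhds
      (x := P0.center) hW)
  have hseq : Tendsto (fun k => of (seq i k) - of (lim i)) atTop (𝓝 0) := by
    rw [← sub_self (of (lim i))]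
    exact (((continuous_of G0).tendsto _).comp (tendsto_seq i)).sub_const _
  obtain ⟨k, hk⟩ := (hseq.eventually_mem hU).exists
  have hfan : of (fan i k) ∈ W := hi (Or.inr ⟨i, k, le_rfl, rfl⟩)
  exact ⟨i, k, hUW (Set.mk_mem_prod hk hfan)⟩

/-- The indicator function of the union of all cells, restricted to `A₃(G₀)`. -/
noncomputable def cellIndicator : A 3 G0 → ℝ :=
  Set.indicator {g | ∃ d, (g : FreeAbTop G0) ∈ cell d} 1

theorem continuousOn_cellIndicator {K : Set (A 3 G0)} (hK : IsCompact K) :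
    ContinuousOn cellIndicator K := by
  -- On `K` the union of all cells agrees with the clopen union of the finitely many cells that meet
  -- `K`.
  have hfin := finite_cell_inter (hK.image continuous_subtype_val)
  have hclopen := (hfin.isClopen_biUnion fun d _ => isClopen_cell d).preimage
    (continuous_subtype_val (p := (· ∈ A 3 G0)))
  refine (hclopen.continuous_indicator (f := (1 : A 3 G0 → ℝ))
    continuous_one).continuousOn.congr fun g hg => ?_
  refine Set.indicator_eq_indicator ?_ rfl
  simp only [Set.mem_ofPred_eq, Set.mem_preimage, Set.mem_iUnion, exists_prop]
  exact ⟨fun ⟨d, hd⟩ => ⟨d, ⟨g, hd, g, hg, rfl⟩, hd⟩, fun ⟨d, _, hd⟩ => ⟨d, hd⟩⟩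

theorem not_continuous_cellIndicator : ¬ Continuous cellIndicator := by
  intro hf
  let c : A 3 G0 := ⟨of center, (length_of_le _).trans (by norm_num)⟩
  have hc : cellIndicator c = 0 :=
    Set.indicator_of_notMem
      (show c ∉ {g : A 3 G0 | ∃ e, (g : FreeAbTop G0) ∈ cell e} from
        not_exists.2 of_center_notMem_cell) _
  have hlt : {g | cellIndicator g < 1} ∈ 𝓝 c :=
    (isOpen_lt hf continuous_const).mem_nhds (by simp [hc])
  obtain ⟨N, hN, hsub⟩ := mem_nhds_subtype _ _ _ |>.1 hlt
  obtain ⟨i, k, hik⟩ := exists_mem_of_mem_nhds_center hN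
  let d : A 3 G0 := ⟨of (seq i k) - of (lim i) + of (fan i k), length_sub_add_le (seq_ne_lim i k i) (seq_ne_fan i k i k)
    (lim_ne_fan i i k)⟩
  have hd : cellIndicator d = 1 := Set.indicator_of_mem
    (show d ∈ {g : A 3 G0 | ∃ e, (g : FreeAbTop G0) ∈ cell e} from ⟨(i, k), mem_cell i k⟩) _
  have h1 : cellIndicator d < 1 := hsub (show (d : FreeAbTop G0) ∈ N from hik)
  exact h1.ne hd

end G0

end KRFree

theorem mainTheorem11 :
    ¬ KRFree.IsKRSpace (KRFree.A 3 KRFree.G0) ∧ ¬ CompactlyCoherentSpace (KRFree.A 3 KRFree.G0) := by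
  refine ⟨fun h => KRFree.G0.not_continuous_cellIndicator ((h.2 _).2 fun K hK =>
    KRFree.G0.continuousOn_cellIndicator hK), fun h => ?_⟩
  exact KRFree.G0.not_continuous_cellIndicator
    (h.isCoherentWith.continuous_iff.2 fun K hK => KRFree.G0.continuousOn_cellIndicator hK)
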